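/- Let $X$ be a real Banach space with dual $X^*$, let $T$ be an arbitrary index set, and for each $t\in T$ let $f_t:X\to\mathbb{R}\cup\{\infty\}$ be a proper lower semicontinuous convex function with conjugate $f_t^*(u^*)=\sup_{x\in X}\{\langle u^*,x\rangle-f_t(x)\}$ and $\mathrm{dom}\,f_t^*=\{u^*\in X^*: f_t^*(u^*)<\infty\}$. Let $l_\infty(T)$ be the Banach space of bounded functions $p:T\to\mathbb{R}$ with the supremum norm, and let $\mathcal F:l_\infty(T)\rightrightarrows X$ be given by $$\mathcal F(p)=\{x\in X:\ f_t(x)\le p_t\ \text{for all } t\in T\}.$$ Let $\bar x\in\mathcal F(0)$, and let $C(0)\subset X^*\times\mathbb{R}$ be the convex hull of $\bigcup_{t\in T}\{(u^*,f_t^*(u^*)):u^*\in\mathrm{dom}\,f_t^*\}$, with $\mathrm{cl}^*C(0)$ its closure in the product of the weak$^*$ topology of $X^*$ and the usual topology of $\mathbb{R}$. The mapping $\mathcal F$ is Lipschitz-like around $(0,\bar x)$ with modulus $\ell\ge0$ if there are neighborhoods $U$ of $0$ and $V$ of $\bar x$ such that $\mathcal F(p)\cap V\subset\mathcal F(q)+\ell\|p-q\|\mathbb{B}$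 for all $p,q\in U$, where $\mathbb{B}$ is the closed unit ball of $X$; it is Lipschitz-like around $(0,\bar x)$ if this holds for some $\ell\ge 0$. The exact Lipschitzian bound $\mathrm{lip}\,\mathcal F(0,\bar x)\in[0,\infty]$ is the infimum of all such moduli $\ell$ (with $\inf\emptyset=\infty$). The coderivative is $$D^*\mathcal F(0,\bar x)(x^*)=\{p^*\in l_\infty(T)^*:\ (p^*,-x^*)\in N((0,\bar x);\mathrm{gph}\,\mathcal F)\},$$ where $N$ is the basic (limiting) normal cone: $\xi\in N(\bar w;\Omega)$ for $\bar w\in\Omega$ if and only if there are $\varepsilon_k\ge 0$ with $\varepsilon_k\to0$, points $w_k\in\Omega$ with $w_k\to\bar w$ in norm, and functionals $\xi_k\to\xi$ in the weak$^*$ topology such that $\limsup_{w\to w_k,\,w\in\Omega,\,w\ne w_k}\langle\xi_k,w-w_k\rangle/\|w-w_k\|\le\varepsilon_k$ for every $k\in\mathbb{N}$. A point $\hat x\in X$ is a strong Slater point if $\sup_{t\in T}f_t(\hat x)<0$ (with $\sup\emptyset=-\infty$), and the strong Slater condition holds if such a point exists. Then $\mathcal F$ is Lipschitz-like around $(0,\bar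 x)$ if and only if $D^*\mathcal F(0,\bar x)(0)=\{0\}$. If, furthermore, the strong Slater condition holds and the set $\bigcup_{t\in T}\mathrm{dom}\,f_t^*$ is bounded in $X^*$, then: (i) if $\bar x$ is a strong Slater point, then $\mathrm{lip}\,\mathcal F(0,\bar x)=0$; (ii) if $\bar x$ is not a strong Slater point, then the maximum below is attained, is finite, and $$\mathrm{lip}\,\mathcal F(0,\bar x)=\max\bigl\{\|u^*\|^{-1}:\ (u^*,\langle u^*,\bar x\rangle)\in\mathrm{cl}^*C(0)\bigr\}>0;$$ in particular every $u^*$ occurring here is nonzero. -/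

import Mathlib

open Filter Topology Set
open scoped NNReal ENNReal Pointwise

noncomputable section

namespace ConvexSystem

/-! Lipschitz-like multifunctions and their exact Lipschitzian bound. -/

section VariationalAnalysis

variable {Z Y E : Type*}
  [NormedAddCommGroup Z] [NormedSpace ℝ Z]
  [NormedAddCommGroup Y] [NormedSpace ℝ Y]
  [NormedAddCommGroup E] [NormedSpace ℝ E]

/-- `F` is Lipschitz-like (has the Aubin property) around `(z₀, y₀)` with modulus `ℓ`. -/
def LipschitzLikeWith (F : Z → Set Y) (z₀ : Z) (y₀ : Y) (ℓ : ℝ≥0) : Prop :=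
  ∃ U ∈ 𝓝 z₀, ∃ V ∈ 𝓝 y₀, ∀ z ∈ U, ∀ u ∈ U,
    F z ∩ V ⊆ F u + ((ℓ : ℝ) * ‖z - u‖) • Metric.closedBall (0 : Y) 1

/-- `F` is Lipschitz-like around `(z₀, y₀)`. -/
def LipschitzLike (F : Z → Set Y) (z₀ : Z) (y₀ : Y) : Prop :=
  ∃ ℓ : ℝ≥0, LipschitzLikeWith F z₀ y₀ ℓ

/-- The exact Lipschitzian bound of `F` around `(z₀, y₀)`: the infimum of all moduli
(`∞` if there is none). -/
def lip (F : Z → Set Y) (z₀ : Z) (y₀ : Y) : ℝ≥0∞ :=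
  ⨅ (ℓ : ℝ≥0) (_ : LipschitzLikeWith F z₀ y₀ ℓ), (ℓ : ℝ≥0∞)

/-- The set of `ε`-normals to `Ω` at `x`: functionals `ξ` with
`limsup ⟨ξ, u - x⟩ / ‖u - x‖ ≤ ε` as `u → x`, `u ∈ Ω`, `u ≠ x` (empty if `x ∉ Ω`). -/
def epsNormals (Ω : Set E) (ε : ℝ) (x : E) : Set (StrongDual ℝ E) :=
  {ξ | x ∈ Ω ∧ ∀ γ > 0, ∀ᶠ u in 𝓝[Ω] x, ξ (u - x) ≤ (ε + γ) * ‖u - x‖}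

/-- The basic (limiting, Mordukhovich) normal cone to `Ω` at `x₀`: sequential weak-star limits of
`ε k`-normals at points `x k` of `Ω`, where `x k → x₀` in norm and `ε k → 0`
(empty if `x₀ ∉ Ω`). -/
def limitingNormalCone (Ω : Set E) (x₀ : E) : Set (StrongDual ℝ E) :=
  {ξ₀ | x₀ ∈ Ω ∧ ∃ (ε : ℕ → ℝ) (x : ℕ → E) (ξ : ℕ → StrongDual ℝ E),
    (∀ k, 0 ≤ ε k) ∧ Tendsto ε atTop (𝓝 0) ∧ Tendsto x atTop (𝓝 x₀) ∧
    (∀ k, ξ k ∈ epsNormals Ω (ε k) (x k)) ∧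
    Tendsto (fun k => StrongDual.toWeakDual (ξ k)) atTop (𝓝 (StrongDual.toWeakDual ξ₀))}

/-- The graph of a multifunction. -/
def graph (F : Z → Set Y) : Set (Z × Y) := {q | q.2 ∈ F q.1}

/-- The (normal) coderivative `D*F(z₀, y₀) : Y* ⇉ Z*`; the pair `(z*, -y*)` is regarded as the
functional `(z, y) ↦ ⟨z*, z⟩ - ⟨y*, y⟩` on `Z × Y`. -/
def coderivative (F : Z → Set Y) (z₀ : Z) (y₀ : Y) (η : StrongDual ℝ Y) :
    Set (StrongDual ℝ Z) :=
  {ζ | ζ.coprod (-η) ∈ limitingNormalCone (graph F) (z₀, y₀)}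

end VariationalAnalysis

/-! Infinite convex inequality systems. -/

section Systems

variable {X T : Type*} [NormedAddCommGroup X] [NormedSpace ℝ X]

/-- `g : X → ℝ ∪ {∞}` is a proper lower semicontinuous convex function. -/
structure IsProperLscConvex (g : X → EReal) : Prop where
  ne_bot : ∀ x, g x ≠ ⊥
  exists_ne_top : ∃ x, g x ≠ ⊤
  lsc : LowerSemicontinuous g
  convex_epigraph : Convex ℝ {q : X × ℝ | g q.1 ≤ (q.2 : EReal)}

/-- The Fenchel-Legendre conjugate `g*(u) = sup_x (⟨u, x⟩ - g x)`. -/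
def conjugate (g : X → EReal) (u : StrongDual ℝ X) : EReal :=
  ⨆ x, (((u x : ℝ) : EReal) - g x)

/-- The effective domain of the conjugate of `g`. -/
def domConjugate (g : X → EReal) : Set (StrongDual ℝ X) := {u | conjugate g u < ⊤}

/-- The graph of the conjugate of `g`, as a subset of `X* × ℝ` where `X*` carries the weak-star
topology. -/
def graphConjugate (g : X → EReal) : Set (WeakDual ℝ X × ℝ) :=
  {q | conjugate g (WeakDual.toStrongDual q.1) = (q.2 : EReal)}

/-- The characteristic set `C(0)`: the convex hull of the union of the graphs of the
conjugates. -/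
def charSet (f : T → X → EReal) : Set (WeakDual ℝ X × ℝ) :=
  convexHull ℝ (⋃ t, graphConjugate (f t))

/-- The feasible solution map `F(p) = {x | f_t(x) ≤ p_t for all t}` on `l_∞(T)`. -/
def feasible (f : T → X → EReal) (p : lp (fun _ : T => ℝ) ∞) : Set X :=
  {x | ∀ t, f t x ≤ ((p t : ℝ) : EReal)}

/-- `x` is a strong Slater point of the system `f_t ≤ 0`, `t ∈ T`. -/
def IsStrongSlaterPoint (f : T → X → EReal) (x : X) : Prop := (⨆ t, f t x) < 0

/-- The strong Slater condition. -/
def StrongSlaterCondition (f : T → X → EReal) : Prop := ∃ x, IsStrongSlaterPoint f x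

end Systems

end ConvexSystem

end

/-! The graph of `feasible f` is convex, so its limiting normals are the normals of convex analysis,
and the coderivative at `0` consists of the functionals that are nonpositive on the domain of
`feasible f` (`coderivative_feasible_zero`). That domain has interior points, so by Hahn-Banach only
`0` is such a functional exactly when `0` is interior. This amounts to the strong Slater condition,
and pulling points towards a Slater point gives the Lipschitz-like property.

For the exact bound, Fenchel-Moreau makes a uniform estimate `f t x ≤ a` equivalent to `⟨u, x⟩ - α ≤
a` for all `(u, α)` in the closed characteristic set. If `(u, ⟨u, x₀⟩)` lies there, lowering all
right-hand sides by `ε` forces a move of length at least `ε / ‖u‖`, so every modulus is at least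
`‖u‖⁻¹`. Conversely, if the estimate with `ℓ` fails for some `p`, `q` near `0`, a ball of radius `ℓ
* ‖p - q‖` misses `feasible f q`. Separation then gives an affine minorant of slope at most `ℓ⁻¹`
and, below it, a pair of the closed characteristic set that is almost active at `x₀`. Bounded
conjugate domains make the relevant sublevel sets weak-star compact; this excludes such pairs when
`ℓ⁻¹` is below all active norms, and it also yields the minimal norm. -/

namespace ConvexSystem

/-! ### Normals and coderivatives for convex sets and graphs. -/

section VariationalAnalysis

variable {E : Type*} [NormedAddCommGroup E] [NormedSpace ℝ E]

/-- For a convex set, the local estimate defining an `ε`-normal is global. -/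
lemma epsNormals_apply_le {Ω : Set E} (hΩ : Convex ℝ Ω) {ε : ℝ} {x u : E} {ξ : StrongDual ℝ E}
    (hξ : ξ ∈ epsNormals Ω ε x) (hu : u ∈ Ω) : ξ (u - x) ≤ ε * ‖u - x‖ := by
  obtain ⟨hx, h⟩ := hξ
  have key : ∀ γ > 0, ξ (u - x) ≤ (ε + γ) * ‖u - x‖ := by
    intro γ hγ
    -- The segment from `x` to `u` enters every neighborhood of `x`, and both sides of the estimate
    -- are homogeneous in `s`.
    have ht : Tendsto (fun s : ℝ => x + s • (u - x)) (𝓝[>] 0) (𝓝[Ω] x) := by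
      apply tendsto_nhdsWithin_of_tendsto_nhds_of_eventually_within
      · have : Tendsto (fun s : ℝ => x + s • (u - x)) (𝓝 0) (𝓝 (x + (0 : ℝ) • (u - x))) :=
          Continuous.tendsto (by fun_prop) 0
        simpa using this.mono_left nhdsWithin_le_nhds
      · filter_upwards [Ioc_mem_nhdsGT (zero_lt_one' ℝ)] with s hs
        exact hΩ.add_smul_sub_mem hx hu ⟨hs.1.le, hs.2⟩
    obtain ⟨s, hs, hs0⟩ := ((ht.eventually (h γ hγ)).and self_mem_nhdsWithin).exists
    have hs0 : 0 < s := hs0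
    simp only [add_sub_cancel_left, map_smul, smul_eq_mul, norm_smul, Real.norm_eq_abs,
      abs_of_pos hs0] at hs
    refine le_of_mul_le_mul_left ?_ hs0
    linarith
  have hlim : Tendsto (fun γ : ℝ => (ε + γ) * ‖u - x‖) (𝓝[>] 0) (𝓝 ((ε + 0) * ‖u - x‖)) :=
    (Continuous.tendsto (by fun_prop) 0).mono_left nhdsWithin_le_nhds
  rw [add_zero] at hlim
  exact ge_of_tendsto hlim (by filter_upwards [self_mem_nhdsWithin] with γ hγ using key γ hγ)

/-- The limiting normal cone to a convex set is contained in the normal cone of convex analysis. -/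
lemma limitingNormalCone_apply_le [CompleteSpace E] {Ω : Set E} (hΩ : Convex ℝ Ω) {x₀ u : E}
    {ξ : StrongDual ℝ E} (hξ : ξ ∈ limitingNormalCone Ω x₀) (hu : u ∈ Ω) : ξ (u - x₀) ≤ 0 := by
  obtain ⟨-, ε, x, η, -, hε, hx, hη, hlim⟩ := hξ
  have hpt : ∀ z, Tendsto (fun k => η k z) atTop (𝓝 (ξ z)) := fun z =>
    ((WeakDual.eval_continuous z).tendsto _).comp hlim
  -- Weak-star convergence alone does not control `η k (x k - x₀)`; uniform boundedness does.
  obtain ⟨C, hC⟩ : ∃ C, ∀ k, ‖η k‖ ≤ C := by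
    refine banach_steinhaus fun z => ?_
    obtain ⟨C, hC⟩ := (Metric.isBounded_range_of_tendsto _ (hpt z)).exists_norm_le
    exact ⟨C, fun k => hC _ (mem_range_self k)⟩
  have hx' : Tendsto (fun k => x k - x₀) atTop (𝓝 0) := by simpa using hx.sub_const x₀
  have h0 : Tendsto (fun k => η k (x k - x₀)) atTop (𝓝 0) := by
    refine squeeze_zero_norm (fun k => ?_) (a := fun k => C * ‖x k - x₀‖) ?_
    · exact ((η k).le_opNorm _).trans (by gcongr; exact hC k)
    · simpa using hx'.norm.const_mul C
  have hl : Tendsto (fun k => η k (u - x₀) - η k (x k - x₀)) atTop (𝓝 (ξ (u - x₀))) := by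
    simpa using (hpt (u - x₀)).sub h0
  have hr : Tendsto (fun k => ε k * ‖u - x k‖) atTop (𝓝 0) := by
    simpa using hε.mul (hx.const_sub u).norm
  refine le_of_tendsto_of_tendsto' hl hr fun k => ?_
  rw [← map_sub, sub_sub_sub_cancel_right]
  exact epsNormals_apply_le hΩ (hη k) hu

/-- Normals in the sense of convex analysis are limiting normals. -/
lemma mem_limitingNormalCone {Ω : Set E} {x₀ : E} (hx₀ : x₀ ∈ Ω) {ξ : StrongDual ℝ E}
    (h : ∀ u ∈ Ω, ξ (u - x₀) ≤ 0) : ξ ∈ limitingNormalCone Ω x₀ := by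
  refine ⟨hx₀, fun _ => 0, fun _ => x₀, fun _ => ξ, fun _ => le_rfl, tendsto_const_nhds,
    tendsto_const_nhds, fun _ => ⟨hx₀, fun γ hγ => ?_⟩, tendsto_const_nhds⟩
  filter_upwards [self_mem_nhdsWithin] with u hu
  exact (h u hu).trans (by positivity)

/-- The coderivative at `0` of a multifunction with convex graph consists of the functionals that
are maximal at the base point over the domain. -/
lemma coderivative_zero_of_convex {Z Y : Type*} [NormedAddCommGroup Z] [NormedSpace ℝ Z]
    [CompleteSpace Z] [NormedAddCommGroup Y] [NormedSpace ℝ Y] [CompleteSpace Y] {F : Z → Set Y}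
    (hF : ∀ z y, y ∈ F z → ∀ w v, v ∈ F w → ∀ a b : ℝ, 0 ≤ a → 0 ≤ b → a + b = 1 →
      a • y + b • v ∈ F (a • z + b • w)) {z₀ : Z} {y₀ : Y} (h₀ : y₀ ∈ F z₀) :
    coderivative F z₀ y₀ 0 = {ζ | ∀ z y, y ∈ F z → ζ (z - z₀) ≤ 0} := by
  have hconv : Convex ℝ (graph F) :=
    fun p hp q hq a b ha hb hab => hF p.1 p.2 hp q.1 q.2 hq a b ha hb hab
  ext ζ
  constructor
  · intro hζ z y hy
    have hu : (z, y) ∈ graph F := hy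
    simpa using limitingNormalCone_apply_le hconv hζ hu
  · intro hζ
    refine mem_limitingNormalCone (Ω := graph F) (x₀ := (z₀, y₀)) h₀ ?_
    rintro ⟨z, y⟩ hy
    simpa using hζ z y hy

end VariationalAnalysis

section Slater

lemma exists_of_isStrongSlaterPoint {X T : Type*} {f : T → X → EReal} {x : X} (h : IsStrongSlaterPoint f x) :
    ∃ δ > (0 : ℝ), ∀ t, f t x ≤ ((-δ : ℝ) : EReal) := by
  obtain ⟨a, ha, ha0⟩ := EReal.lt_iff_exists_real_btwn.1 h
  refine ⟨-a, by simpa using ha0, fun t => ?_⟩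
  rw [neg_neg]
  exact (le_iSup (fun t => f t x) t).trans ha.le

lemma isStrongSlaterPoint_of_forall_le {X T : Type*} {f : T → X → EReal} {x : X} {δ : ℝ} (hδ : 0 < δ)
    (h : ∀ t, f t x ≤ ((-δ : ℝ) : EReal)) : IsStrongSlaterPoint f x :=
  (iSup_le h).trans_lt (by exact_mod_cast neg_lt_zero.2 hδ)

end Slater

/-! ### Strong Slater condition, Lipschitz-like property and coderivative criterion. -/

section Systems

variable {X T : Type*} [NormedAddCommGroup X] [NormedSpace ℝ X]

/-- The constant function `c` as an element of `l_∞(T)`. -/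
def constLp (T : Type*) (c : ℝ) : lp (fun _ : T => ℝ) ∞ :=
  ⟨fun _ => c, memℓp_infty ⟨|c|, by rintro _ ⟨t, rfl⟩; exact le_rfl⟩⟩

@[simp] lemma constLp_apply (c : ℝ) (t : T) : constLp T c t = c := rfl

lemma norm_constLp_le (c : ℝ) : ‖constLp T c‖ ≤ |c| :=
  lp.norm_le_of_forall_le (abs_nonneg c) fun _ => le_rfl

lemma abs_apply_le_norm (p : lp (fun _ : T => ℝ) ∞) (t : T) : |p t| ≤ ‖p‖ :=
  lp.norm_apply_le_norm ENNReal.top_ne_zero p t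

lemma abs_apply_sub_le (p q : lp (fun _ : T => ℝ) ∞) (t : T) : |p t - q t| ≤ ‖p - q‖ := by
  simpa using abs_apply_le_norm (p - q) t

lemma IsProperLscConvex.combo_le {g : X → EReal} (hg : IsProperLscConvex g) {x y : X} {a b α β : ℝ}
    (hx : g x ≤ (a : EReal)) (hy : g y ≤ (b : EReal)) (hα : 0 ≤ α) (hβ : 0 ≤ β) (h : α + β = 1) :
    g (α • x + β • y) ≤ ((α * a + β * b : ℝ) : EReal) :=
  hg.convex_epigraph (x := (x, a)) hx (y := (y, b)) hy hα hβ h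

/-- The feasible map has a convex graph. -/
lemma feasible_combo {f : T → X → EReal} (hf : ∀ t, IsProperLscConvex (f t))
    (p : lp (fun _ : T => ℝ) ∞) (x : X) (hx : x ∈ feasible f p)
    (q : lp (fun _ : T => ℝ) ∞) (y : X) (hy : y ∈ feasible f q)
    (a b : ℝ) (ha : 0 ≤ a) (hb : 0 ≤ b) (hab : a + b = 1) :
    a • x + b • y ∈ feasible f (a • p + b • q) :=
  fun t => (hf t).combo_le (hx t) (hy t) ha hb hab

/-- Under the strong Slater condition the feasible map is Lipschitz-like around every point of
its graph over `0`. -/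
lemma lipschitzLike_of_strongSlater {f : T → X → EReal} (hf : ∀ t, IsProperLscConvex (f t))
    (h : StrongSlaterCondition f) (x₀ : X) : LipschitzLike (feasible f) 0 x₀ := by
  obtain ⟨y, hy⟩ := h
  obtain ⟨δ, hδ, hy⟩ := exists_of_isStrongSlaterPoint hy
  have hL : 0 ≤ (‖y - x₀‖ + 1) / (δ / 2) := by positivity
  refine ⟨⟨_, hL⟩, Metric.ball 0 (δ / 2), Metric.ball_mem_nhds _ (by positivity),
    Metric.ball x₀ 1, Metric.ball_mem_nhds _ one_pos, ?_⟩
  rintro p - q hq x ⟨hxp, hx⟩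
  rw [mem_ball_zero_iff] at hq
  rw [mem_ball_iff_norm] at hx
  change x ∈ feasible f q + (((‖y - x₀‖ + 1) / (δ / 2)) * ‖p - q‖) • Metric.closedBall (0 : X) 1
  rw [smul_unitClosedBall_of_nonneg (by positivity)]
  set r := ‖p - q‖ with hr
  have hr0 : 0 ≤ r := norm_nonneg _
  -- Since `p t ≤ q t + r` and `-δ ≤ q t - δ / 2`, the combination with weight `l` is bounded by `q
  -- t + r - l * (r + δ / 2)`; this `l` makes it exactly `q t`.
  set l := r / (r + δ / 2) with hl
  have hl0 : 0 ≤ l := by positivity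
  have hl1 : l ≤ 1 := div_le_one_of_le₀ (by linarith) (by positivity)
  have hlr : l * (r + δ / 2) = r := div_mul_cancel₀ _ (by positivity)
  refine Set.mem_add.2 ⟨(1 - l) • x + l • y, fun t => ?_, l • (x - y), ?_, by module⟩
  · refine ((hf t).combo_le (hxp t) (hy t) (by linarith) hl0 (by ring)).trans ?_
    rw [EReal.coe_le_coe_iff]
    have h1 := (abs_le.1 (abs_apply_sub_le p q t)).2
    have h2 := (abs_le.1 (abs_apply_le_norm q t)).1
    nlinarith
  · rw [mem_closedBall_zero_iff, norm_smul, Real.norm_eq_abs, abs_of_nonneg hl0]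
    have h1 : ‖x - y‖ ≤ ‖y - x₀‖ + 1 := by
      have := norm_sub_le_norm_sub_add_norm_sub x x₀ y
      rw [norm_sub_rev x₀ y] at this
      linarith
    have h2 : l ≤ r / (δ / 2) := by
      rw [hl]; gcongr; linarith
    calc l * ‖x - y‖ ≤ r / (δ / 2) * (‖y - x₀‖ + 1) := by gcongr
      _ = _ := by ring

lemma ball_subset_dom_of_lipschitzLike {f : T → X → EReal} {x₀ : X} (hx₀ : x₀ ∈ feasible f 0)
    (h : LipschitzLike (feasible f) 0 x₀) :
    ∃ δ > 0, ∀ p : lp (fun _ : T => ℝ) ∞, ‖p‖ < δ → (feasible f p).Nonempty := by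
  obtain ⟨ℓ, U, hU, V, hV, h⟩ := h
  obtain ⟨δ, hδ, hδU⟩ := Metric.mem_nhds_iff.1 hU
  refine ⟨δ, hδ, fun p hp => ?_⟩
  obtain ⟨y, hy, -⟩ := h 0 (mem_of_mem_nhds hU) p (hδU (by simpa using hp))
    ⟨hx₀, mem_of_mem_nhds hV⟩
  exact ⟨y, hy⟩

lemma coderivative_feasible_zero [CompleteSpace X] {f : T → X → EReal}
    (hf : ∀ t, IsProperLscConvex (f t)) {x₀ : X} (hx₀ : x₀ ∈ feasible f 0) :
    coderivative (feasible f) 0 x₀ 0 = {ζ | ∀ p x, x ∈ feasible f p → ζ p ≤ 0} := by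
  rw [coderivative_zero_of_convex (feasible_combo hf) hx₀]
  simp only [sub_zero]

/-- If `0` is interior to the domain, a small negative constant is feasible, which is a Slater
point. Otherwise a hyperplane supporting the domain at `0` is a nonzero element of the coderivative.
-/
lemma strongSlater_of_coderivative_eq [CompleteSpace X] {f : T → X → EReal}
    (hf : ∀ t, IsProperLscConvex (f t)) {x₀ : X} (hx₀ : x₀ ∈ feasible f 0)
    (h : coderivative (feasible f) 0 x₀ 0 = {0}) : StrongSlaterCondition f := by
  rw [coderivative_feasible_zero hf hx₀] at h
  set D : Set (lp (fun _ : T => ℝ) ∞) := {p | (feasible f p).Nonempty} with hD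
  have hconv : Convex ℝ D := by
    rintro p ⟨x, hx⟩ q ⟨y, hy⟩ a b ha hb hab
    exact ⟨_, feasible_combo hf p x hx q y hy a b ha hb hab⟩
  have hint : constLp T 1 ∈ interior D := by
    refine mem_interior_iff_mem_nhds.2 (Metric.mem_nhds_iff.2 ⟨1, one_pos, fun p hp => ?_⟩)
    refine ⟨x₀, fun t => (hx₀ t).trans ?_⟩
    rw [EReal.coe_le_coe_iff]
    rw [mem_ball_iff_norm] at hp
    have := (abs_le.1 (abs_apply_sub_le p (constLp T 1) t)).1
    simp only [constLp_apply] at this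
    simp only [lp.coeFn_zero, Pi.zero_apply]
    linarith
  by_cases h0 : (0 : lp (fun _ : T => ℝ) ∞) ∈ interior D
  · obtain ⟨δ, hδ, hsub⟩ := Metric.mem_nhds_iff.1 (mem_interior_iff_mem_nhds.1 h0)
    have hmem : constLp T (-(δ / 2)) ∈ D := by
      apply hsub
      rw [mem_ball_zero_iff]
      refine (norm_constLp_le _).trans_lt ?_
      rw [abs_neg, abs_of_pos (by positivity)]
      linarith
    obtain ⟨y, hy⟩ := hmem
    exact ⟨y, isStrongSlaterPoint_of_forall_le (half_pos hδ) hy⟩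
  · obtain ⟨ζ, hζ0, hζ⟩ := geometric_hahn_banach_of_nonempty_interior_point hconv h0 ⟨_, hint⟩
    refine absurd (?_ : ζ ∈ ({0} : Set _)) hζ0
    rw [← h]
    intro p x hx
    simpa using hζ p ⟨x, hx⟩

lemma lipschitzLike_iff_coderivative_eq [CompleteSpace X] {f : T → X → EReal}
    (hf : ∀ t, IsProperLscConvex (f t)) {x₀ : X} (hx₀ : x₀ ∈ feasible f 0) :
    LipschitzLike (feasible f) 0 x₀ ↔ coderivative (feasible f) 0 x₀ 0 = {0} := by
  refine ⟨fun h => ?_, fun h =>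
    lipschitzLike_of_strongSlater hf (strongSlater_of_coderivative_eq hf hx₀ h) x₀⟩
  obtain ⟨δ, hδ, hne⟩ := ball_subset_dom_of_lipschitzLike hx₀ h
  rw [coderivative_feasible_zero hf hx₀]
  ext ζ
  refine ⟨fun hζ => ?_, fun hζ p x _ => by simp [mem_singleton_iff.1 hζ]⟩
  -- The domain contains a ball around `0`, and a functional nonpositive on a symmetric ball
  -- vanishes.
  have hle : ∀ p, ‖p‖ < δ → ζ p ≤ 0 := fun p hp => by
    obtain ⟨x, hx⟩ := hne p hp
    exact hζ p x hx
  have hball : ∀ p, ‖p‖ < δ → ζ p = 0 := fun p hp =>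
    le_antisymm (hle p hp) (by simpa using hle (-p) (by simpa using hp))
  refine ContinuousLinearMap.ext fun p => ?_
  have hpos : 0 < δ / (2 * (‖p‖ + 1)) := by positivity
  have := hball ((δ / (2 * (‖p‖ + 1))) • p) (by
    rw [norm_smul, Real.norm_eq_abs, abs_of_pos hpos, div_mul_eq_mul_div, div_lt_iff₀ (by positivity)]
    nlinarith [norm_nonneg p])
  rw [map_smul, smul_eq_mul] at this
  simpa using (mul_eq_zero.1 this).resolve_left hpos.ne'

end Systems

end ConvexSystem

namespace ConvexSystem

/-! ### Affine minorants and the Fenchel-Moreau theorem. -/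

section Conjugate

variable {X : Type*} [NormedAddCommGroup X] [NormedSpace ℝ X]

/-- A continuous linear functional on `Y × ℝ` splits into its two components. -/
lemma strongDual_prod_apply {Y : Type*} [AddCommGroup Y] [Module ℝ Y] [TopologicalSpace Y]
    (φ : StrongDual ℝ (Y × ℝ)) (y : Y) (s : ℝ) :
    φ (y, s) = φ.comp (ContinuousLinearMap.inl ℝ Y ℝ) y + φ (0, 1) * s := by
  have h1 : φ (0, s) = φ (0, 1) * s := by
    have : ((0 : Y), s) = s • ((0 : Y), (1 : ℝ)) := by simp
    rw [this, map_smul, smul_eq_mul, mul_comm]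
  rw [← h1, ContinuousLinearMap.comp_apply, ContinuousLinearMap.inl_apply, ← map_add]
  simp

lemma IsProperLscConvex.isClosed_epigraph {g : X → EReal} (hg : IsProperLscConvex g) :
    IsClosed {q : X × ℝ | g q.1 ≤ (q.2 : EReal)} := by
  have h : IsClosed {q : X × EReal | g q.1 ≤ q.2} := hg.lsc.isClosed_epigraph
  exact h.preimage (continuous_fst.prodMk (continuous_coe_real_ereal.comp continuous_snd))

/-- A point strictly below the graph is separated from the epigraph by a hyperplane. -/
lemma IsProperLscConvex.exists_separating {g : X → EReal} (hg : IsProperLscConvex g) {x : X}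
    {a : ℝ} (h : (a : EReal) < g x) : ∃ (w : StrongDual ℝ X) (β c : ℝ), 0 ≤ β ∧
      w x + β * a < c ∧ ∀ y (s : ℝ), g y ≤ s → c < w y + β * s := by
  obtain ⟨φ, c, hc, hφ⟩ := geometric_hahn_banach_point_closed hg.convex_epigraph
    hg.isClosed_epigraph (x := (x, a)) (by simpa using h)
  refine ⟨φ.comp (ContinuousLinearMap.inl ℝ X ℝ), φ (0, 1), c, ?_, ?_, fun y s hy => ?_⟩
  · obtain ⟨y, hy⟩ := hg.exists_ne_top
    -- Going up the epigraph over a point of the domain would violate the lower bound `c` if `β`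
    -- were negative.
    lift g y to ℝ using ⟨hy, hg.ne_bot y⟩ with s hs
    by_contra! hneg
    obtain ⟨n, hn⟩ := exists_nat_gt
      ((φ.comp (ContinuousLinearMap.inl ℝ X ℝ) y + φ (0, 1) * s - c) / (-φ (0, 1)))
    have := hφ (y, s + n) (by
      simp only [Set.mem_ofPred_eq, ← hs, EReal.coe_le_coe_iff]
      exact le_add_of_nonneg_right n.cast_nonneg)
    rw [strongDual_prod_apply] at this
    rw [div_lt_iff₀ (by linarith)] at hn
    linarith
  · rwa [strongDual_prod_apply] at hc
  · have := hφ (y, s) hy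
    rwa [strongDual_prod_apply] at this

lemma affine_le_of_separating {g : X → EReal} (hg : IsProperLscConvex g) {w : StrongDual ℝ X}
    {β c : ℝ} (hβ : 0 < β) (h : ∀ y (s : ℝ), g y ≤ s → c < w y + β * s) (y : X) :
    (((-β⁻¹ • w) y - (-β⁻¹ * c) : ℝ) : EReal) ≤ g y := by
  induction hs : g y with
  | bot => exact absurd hs (hg.ne_bot y)
  | top => exact le_top
  | coe s =>
    rw [EReal.coe_le_coe_iff]
    have := h y s hs.le
    have h2 : β⁻¹ * c ≤ β⁻¹ * (w y + β * s) := by gcongr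
    rw [mul_add, inv_mul_cancel_left₀ hβ.ne'] at h2
    simp only [smul_apply, smul_eq_mul, neg_mul]
    linarith

lemma IsProperLscConvex.exists_affine_le {g : X → EReal} (hg : IsProperLscConvex g) :
    ∃ (v : StrongDual ℝ X) (γ : ℝ), ∀ y, ((v y - γ : ℝ) : EReal) ≤ g y := by
  obtain ⟨y, hy⟩ := hg.exists_ne_top
  lift g y to ℝ using ⟨hy, hg.ne_bot y⟩ with s hs
  obtain ⟨w, β, c, -, hc, h⟩ := hg.exists_separating (x := y) (a := s - 1) (by
    rw [← hs, EReal.coe_lt_coe_iff]; linarith)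
  have := h y s hs.ge
  exact ⟨_, _, affine_le_of_separating hg (by nlinarith) h⟩

/-- The Fenchel-Moreau theorem in geometric form: a proper lower semicontinuous convex function is
the supremum of its continuous affine minorants. -/
lemma IsProperLscConvex.exists_affine_le_of_lt {g : X → EReal} (hg : IsProperLscConvex g) {x : X}
    {a : ℝ} (ha : (a : EReal) < g x) :
    ∃ (v : StrongDual ℝ X) (γ : ℝ), (∀ y, ((v y - γ : ℝ) : EReal) ≤ g y) ∧ a < v x - γ := by
  obtain ⟨w, β, c, hβ, hc, h⟩ := hg.exists_separating ha
  -- When `β = 0` the hyperplane is vertical: `c - w` is negative on the domain of `g` and positive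
  -- at `x`, so a large multiple of it is added to some affine minorant.
  rcases hβ.eq_or_lt with rfl | hβ
  · obtain ⟨v, γ, hv⟩ := hg.exists_affine_le
    simp only [zero_mul, add_zero] at hc h
    obtain ⟨n, hn⟩ := exists_nat_gt ((a - (v x - γ)) / (c - w x))
    rw [div_lt_iff₀ (by linarith)] at hn
    refine ⟨v - (n : ℝ) • w, γ - n * c, fun y => ?_, ?_⟩
    · induction hs : g y with
      | bot => exact absurd hs (hg.ne_bot y)
      | top => exact le_top
      | coe s =>
        rw [EReal.coe_le_coe_iff]
        have h1 := h y s hs.le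
        have h2 := hv y
        rw [hs, EReal.coe_le_coe_iff] at h2
        have h3 : (n : ℝ) * c ≤ n * w y := by gcongr
        simp only [sub_apply, smul_apply, smul_eq_mul]
        linarith
    · simp only [sub_apply, smul_apply, smul_eq_mul]
      linarith
  · refine ⟨_, _, affine_le_of_separating hg hβ h, ?_⟩
    have h2 : β⁻¹ * (w x + β * a) < β⁻¹ * c := by gcongr
    rw [mul_add, inv_mul_cancel_left₀ hβ.ne'] at h2
    simp only [smul_apply, smul_eq_mul, neg_mul]
    linarith

lemma conjugate_ne_bot {g : X → EReal} (hg : IsProperLscConvex g) (u : StrongDual ℝ X) :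
    conjugate g u ≠ ⊥ := by
  obtain ⟨y, hy⟩ := hg.exists_ne_top
  lift g y to ℝ using ⟨hy, hg.ne_bot y⟩ with s hs
  refine ((EReal.bot_lt_coe (u y - s)).trans_le ?_).ne'
  refine le_iSup_of_le (f := fun x => ((u x : ℝ) : EReal) - g x) y ?_
  simp [← hs]

/-- The Fenchel-Young inequality. -/
lemma sub_le_of_conjugate_eq {g : X → EReal} (hg : IsProperLscConvex g) {u : StrongDual ℝ X}
    {α : ℝ} (h : conjugate g u = α) {x : X} {a : ℝ} (hx : g x ≤ a) : u x - α ≤ a := by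
  have h1 : ((u x : ℝ) : EReal) - g x ≤ α :=
    h ▸ le_iSup (fun x => ((u x : ℝ) : EReal) - g x) x
  induction hs : g x with
  | bot => exact absurd hs (hg.ne_bot x)
  | top => simp [hs] at hx
  | coe s =>
    rw [hs] at h1 hx
    rw [← EReal.coe_sub, EReal.coe_le_coe_iff] at h1
    rw [EReal.coe_le_coe_iff] at hx
    linarith

/-- The Fenchel-Moreau theorem: an upper bound for the biconjugate bounds the function. -/
lemma le_of_forall_conjugate {g : X → EReal} (hg : IsProperLscConvex g) {x : X} {a : ℝ}
    (h : ∀ (u : StrongDual ℝ X) (α : ℝ), conjugate g u = α → u x - α ≤ a) : g x ≤ a := by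
  by_contra! hlt
  obtain ⟨v, γ, hv, hx⟩ := hg.exists_affine_le_of_lt hlt
  have hle : conjugate g v ≤ γ := by
    refine iSup_le fun y => ?_
    have h2 := hv y
    induction hs : g y with
    | bot => exact absurd hs (hg.ne_bot y)
    | top => simp
    | coe s =>
      rw [hs, EReal.coe_le_coe_iff] at h2
      rw [← EReal.coe_sub, EReal.coe_le_coe_iff]
      linarith
  have htop : conjugate g v ≠ ⊤ := (hle.trans_lt (EReal.coe_lt_top γ)).ne
  obtain ⟨α, hα⟩ : ∃ α : ℝ, conjugate g v = α :=
    ⟨_, (EReal.coe_toReal htop (conjugate_ne_bot hg v)).symm⟩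
  rw [hα, EReal.coe_le_coe_iff] at hle
  linarith [h v α hα]

end Conjugate

/-! ### The closed characteristic set: bounds and weak-star compactness. -/

section CharSet

variable {X T : Type*} [NormedAddCommGroup X] [NormedSpace ℝ X] {f : T → X → EReal}

lemma isLinearMap_weakDual_prod (x : X) :
    IsLinearMap ℝ (fun q : WeakDual ℝ X × ℝ => q.1 x - q.2) where
  map_add p q := by
    change p.1 x + q.1 x - (p.2 + q.2) = _
    ring
  map_smul c q := by
    change c * q.1 x - c * q.2 = c * (q.1 x - q.2)
    ring

lemma continuous_weakDual_prod (x : X) :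
    Continuous (fun q : WeakDual ℝ X × ℝ => q.1 x - q.2) :=
  ((WeakDual.eval_continuous x).comp continuous_fst).sub continuous_snd

/-- Every bound of the system at `x` is inherited by the closure of the characteristic set. -/
lemma sub_le_of_mem_closure_charSet (hf : ∀ t, IsProperLscConvex (f t)) {x : X} {a : ℝ}
    (h : ∀ t, f t x ≤ a) {q : WeakDual ℝ X × ℝ} (hq : q ∈ closure (charSet f)) :
    q.1 x - q.2 ≤ a := by
  refine closure_minimal (convexHull_min (iUnion_subset fun t p hp => ?_)
    (convex_halfSpace_le (isLinearMap_weakDual_prod x) a))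
    (isClosed_le (continuous_weakDual_prod x) continuous_const) hq
  exact sub_le_of_conjugate_eq (hf t) hp (h t)

lemma le_of_forall_charSet (hf : ∀ t, IsProperLscConvex (f t)) {x : X} {a : ℝ}
    (h : ∀ q ∈ charSet f, q.1 x - q.2 ≤ a) (t : T) : f t x ≤ a :=
  le_of_forall_conjugate (hf t) fun u α hu =>
    h (StrongDual.toWeakDual u, α) (subset_convexHull ℝ _ (mem_iUnion.2 ⟨t, hu⟩))

lemma lowerSemicontinuous_weakDual_norm_fst :
    LowerSemicontinuous fun q : WeakDual ℝ X × ℝ => ‖WeakDual.toStrongDual q.1‖ := by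
  refine lowerSemicontinuous_iff_isClosed_preimage.2 fun r => ?_
  have := (WeakDual.isClosed_closedBall (0 : StrongDual ℝ X) r).preimage
    (continuous_fst (X := WeakDual ℝ X) (Y := ℝ))
  simpa [Set.preimage] using this

/-- Norm bounds on the domains of the conjugates pass to the closure of the characteristic set. -/
lemma norm_le_of_mem_closure_charSet {R : ℝ}
    (hR : ∀ t, ∀ u ∈ domConjugate (f t), ‖u‖ ≤ R) {q : WeakDual ℝ X × ℝ}
    (hq : q ∈ closure (charSet f)) : ‖WeakDual.toStrongDual q.1‖ ≤ R := by
  have hconv : Convex ℝ {q : WeakDual ℝ X × ℝ | ‖WeakDual.toStrongDual q.1‖ ≤ R} := by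
    have h := (convexOn_univ_norm (E := StrongDual ℝ X)).convex_le R
    have h2 := h.is_linear_preimage
      (f := fun q : WeakDual ℝ X × ℝ => WeakDual.toStrongDual q.1)
      ((WeakDual.toStrongDual.toLinearMap.comp (LinearMap.fst ℝ (WeakDual ℝ X) ℝ)).isLinear)
    simpa using h2
  have hclosed : IsClosed {q : WeakDual ℝ X × ℝ | ‖WeakDual.toStrongDual q.1‖ ≤ R} :=
    lowerSemicontinuous_weakDual_norm_fst.isClosed_preimage R
  refine closure_minimal (convexHull_min (iUnion_subset fun t p hp => ?_) hconv) hclosed hq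
  refine hR t _ ?_
  change conjugate (f t) _ < ⊤
  rw [show conjugate (f t) (WeakDual.toStrongDual p.1) = (p.2 : EReal) from hp]
  exact EReal.coe_lt_top _

/-- All slopes in the characteristic set have norm at most `R`, so the whole family grows at rate at
most `R`. -/
lemma lipschitz_bound (hf : ∀ t, IsProperLscConvex (f t)) {R : ℝ}
    (hR : ∀ t, ∀ u ∈ domConjugate (f t), ‖u‖ ≤ R) {x : X} {a : ℝ} (h : ∀ t, f t x ≤ a) (y : X)
    (t : T) : f t y ≤ ((a + R * ‖y - x‖ : ℝ) : EReal) := by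
  refine le_of_forall_charSet hf (fun q hq => ?_) t
  have h1 := sub_le_of_mem_closure_charSet hf h (subset_closure hq)
  have h2 := norm_le_of_mem_closure_charSet hR (subset_closure hq)
  have h3 : q.1 (y - x) ≤ R * ‖y - x‖ :=
    (le_abs_self _).trans ((WeakDual.toStrongDual q.1).le_of_opNorm_le h2 _)
  rw [map_sub] at h3
  linarith

/-- Sublevel sets of `(u, α) ↦ α - ⟨u, x⟩` in the closed characteristic set are weak-star
compact. -/
lemma isCompact_charSet_sublevel {x : X} {R : ℝ} (hR : ∀ t, ∀ u ∈ domConjugate (f t), ‖u‖ ≤ R)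
    (hx : ∀ q ∈ closure (charSet f), q.1 x - q.2 ≤ 0) (c : ℝ) :
    IsCompact {q ∈ closure (charSet f) | -c ≤ q.1 x - q.2} := by
  refine ((WeakDual.isCompact_closedBall (0 : StrongDual ℝ X) R).prod
    (isCompact_Icc (a := -(R * ‖x‖)) (b := R * ‖x‖ + c))).of_isClosed_subset
    (isClosed_closure.inter (isClosed_le continuous_const (continuous_weakDual_prod x))) ?_
  rintro q ⟨hq, hqc⟩
  have h2 := norm_le_of_mem_closure_charSet hR hq
  have h3 : |q.1 x| ≤ R * ‖x‖ := (WeakDual.toStrongDual q.1).le_of_opNorm_le h2 _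
  have h4 := hx q hq
  rw [abs_le] at h3
  refine ⟨by simpa using h2, ?_, ?_⟩ <;> linarith

end CharSet

end ConvexSystem

namespace ConvexSystem

/-! ### Computation of the exact Lipschitzian bound. -/

section LipschitzBound

variable {X T : Type*} [NormedAddCommGroup X] [NormedSpace ℝ X] {f : T → X → EReal}

/-- A closed ball around `x` that misses the feasible set yields an affine minorant of
`sup_t (f_t - q_t)` which is nonnegative on the ball. -/
lemma exists_affine_minorant_of_disjoint_closedBall (hf : ∀ t, IsProperLscConvex (f t))
    {q : lp (fun _ : T => ℝ) ∞} {x : X} {r ρ : ℝ} (hρ : 0 < ρ)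
    (hx : ∀ t, f t x ≤ ((q t + r : ℝ) : EReal))
    (hdisj : ∀ y ∈ Metric.closedBall x ρ, y ∉ feasible f q) :
    ∃ (u : StrongDual ℝ X) (γ : ℝ),
      (∀ (z : X) (s : ℝ), (∀ t, f t z ≤ ((q t + s : ℝ) : EReal)) → u z - γ ≤ s) ∧
      ρ * ‖u‖ ≤ u x - γ := by
  have hconv : Convex ℝ {z : X × ℝ | ∀ t, f t z.1 ≤ ((q t + z.2 : ℝ) : EReal)} := by
    intro y hy z hz a b ha hb hab t
    refine ((hf t).combo_le (hy t) (hz t) ha hb hab).trans_eq ?_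
    congr 1
    simp only [Prod.snd_add, Prod.smul_snd, smul_eq_mul]
    linear_combination (q t) * hab
  -- The epigraph of `sup_t (f_t - q_t)` misses the open cylinder below the ball.
  obtain ⟨φ, c, hA, hE⟩ := geometric_hahn_banach_open
    ((convex_ball x ρ).prod (convex_Iio (0 : ℝ))) (Metric.isOpen_ball.prod isOpen_Iio) hconv (by
      rw [Set.disjoint_left]
      rintro ⟨y, s⟩ ⟨hy, hs⟩ h
      refine hdisj y (Metric.ball_subset_closedBall hy) fun t => (h t).trans ?_
      rw [EReal.coe_le_coe_iff]
      have : s < 0 := hs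
      simp only
      linarith)
  set w := φ.comp (ContinuousLinearMap.inl ℝ X ℝ) with hw
  set β := φ (0, 1) with hβ
  have hA' : ∀ y ∈ Metric.ball x ρ, ∀ s < 0, w y + β * s < c := fun y hy s hs => by
    have := hA (y, s) ⟨hy, hs⟩
    rwa [strongDual_prod_apply] at this
  have hE' : ∀ z (s : ℝ), (∀ t, f t z ≤ ((q t + s : ℝ) : EReal)) → c ≤ w z + β * s :=
    fun z s h => by
      have := hE (z, s) h
      rwa [strongDual_prod_apply] at this
  -- The hyperplane is not vertical, because both sets contain points over the center `x`.
  have hβ0 : 0 < β := by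
    have h1 := hE' x (|r|) fun t => (hx t).trans (by
      rw [EReal.coe_le_coe_iff]; linarith [le_abs_self r])
    have h2 := hA' x (Metric.mem_ball_self hρ) (-1) (by norm_num)
    by_contra! h
    nlinarith [abs_nonneg r]
  have hball : ∀ y ∈ Metric.closedBall x ρ, w y ≤ c := by
    intro y hy
    rw [← closure_ball x hρ.ne'] at hy
    refine closure_minimal (fun z hz => ?_) (isClosed_le w.continuous continuous_const) hy
    change w z ≤ c
    refine le_of_forall_pos_lt_add fun ε hε => ?_
    have := hA' z hz (-(ε / β)) (by simpa using div_pos hε hβ0)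
    rw [mul_neg, mul_div_cancel₀ _ hβ0.ne'] at this
    linarith
  refine ⟨-β⁻¹ • w, -β⁻¹ * c, fun z s h => ?_, ?_⟩
  · have h2 : β⁻¹ * c ≤ β⁻¹ * (w z + β * s) := by
      gcongr
      exact hE' z s h
    rw [mul_add, inv_mul_cancel_left₀ hβ0.ne'] at h2
    simp only [smul_apply, smul_eq_mul, neg_mul]
    linarith
  · have hnorm : ‖w‖ ≤ (c - w x) / ρ := by
      refine ContinuousLinearMap.opNorm_bound_of_ball_bound hρ _ w fun z hz => ?_
      rw [mem_closedBall_zero_iff] at hz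
      have h1 := hball (x + z) (by simpa using hz)
      have h2 := hball (x - z) (by simpa using hz)
      rw [map_add] at h1
      rw [map_sub] at h2
      rw [Real.norm_eq_abs, abs_le]
      constructor <;> linarith
    rw [le_div_iff₀ hρ] at hnorm
    have h2 : β⁻¹ * (‖w‖ * ρ) ≤ β⁻¹ * (c - w x) := by gcongr
    rw [norm_smul, norm_neg, Real.norm_eq_abs, abs_of_pos (inv_pos.2 hβ0)]
    simp only [smul_apply, smul_eq_mul]
    linarith

/-- Continuous functionals on `X* × ℝ`, for the weak-star topology of `X*`, are given by points of
`X × ℝ`. -/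
lemma exists_eval_of_weakDual_prod (φ : StrongDual ℝ (WeakDual ℝ X × ℝ)) :
    ∃ (y : X) (s : ℝ), ∀ u a, φ (u, a) = u y + s * a := by
  obtain ⟨y, hy⟩ := LinearMap.dualEmbedding_surjective (topDualPairing ℝ X)
    (φ.comp (ContinuousLinearMap.inl ℝ (WeakDual ℝ X) ℝ))
  refine ⟨y, φ (0, 1), fun u a => ?_⟩
  rw [strongDual_prod_apply]
  exact congrArg (· + _) (DFunLike.congr_fun hy u).symm

instance : LocallyConvexSpace ℝ (WeakDual ℝ X) :=
  inferInstanceAs (LocallyConvexSpace ℝ (WeakBilin (topDualPairing ℝ X)))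

/-- Affine minorants of `sup_t f_t` lie above the weak-star closure of the characteristic set. -/
lemma exists_mem_closure_charSet_le (hf : ∀ t, IsProperLscConvex (f t)) {m : ℝ}
    (hm : ∀ q ∈ closure (charSet f), m ≤ q.2)
    (hne : ∃ z : X, ∃ s : ℝ, ∀ q ∈ charSet f, q.1 z - q.2 ≤ s)
    {u : StrongDual ℝ X} {γ : ℝ}
    (h : ∀ (z : X) (s : ℝ), (∀ t, f t z ≤ s) → u z - γ ≤ s) :
    ∃ γ' ≤ γ, (StrongDual.toWeakDual u, γ') ∈ closure (charSet f) := by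
  by_contra! hcon
  set U := StrongDual.toWeakDual u with hU
  -- The segment over `U` reaches down to `m'`, below all second coordinates in the closed set; this
  -- handles `s ≤ 0`.
  set m' := min m γ with hm'
  have hclosed : IsClosed (closure (charSet f)) := isClosed_closure
  have hconv : Convex ℝ (closure (charSet f)) := (convex_convexHull ℝ _).closure
  obtain ⟨φ, c, d, hc, hcd, hd⟩ := geometric_hahn_banach_compact_closed
    (s := ({U} : Set (WeakDual ℝ X)) ×ˢ Icc m' γ) ((convex_singleton U).prod (convex_Icc m' γ))
    (isCompact_singleton.prod isCompact_Icc) hconv hclosed (by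
      rw [Set.disjoint_left]
      rintro ⟨v, a⟩ ⟨hv, ha⟩ hmem
      obtain rfl : v = U := hv
      exact hcon a ha.2 hmem)
  obtain ⟨y, s, hφ⟩ := exists_eval_of_weakDual_prod φ
  have hcu : ∀ a ∈ Icc m' γ, u y + s * a < c := fun a ha => by
    have := hc (U, a) ⟨rfl, ha⟩
    rwa [hφ] at this
  have hdv : ∀ q ∈ charSet f, d < q.1 y + s * q.2 := fun q hq => by
    have := hd q (subset_closure hq)
    rwa [← Prod.mk.eta (p := q), hφ] at this
  have hb : ∀ (z : X) (s : ℝ), (∀ q ∈ charSet f, q.1 z - q.2 ≤ s) → u z - γ ≤ s :=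
    fun z s hz => h z s (le_of_forall_charSet hf hz)
  -- For `s > 0` the point `-s⁻¹ • y` violates the minorant property. For `s ≤ 0` the separation
  -- survives in the first coordinate alone, and moving from `z` far along `-y` violates it.
  rcases lt_or_ge 0 s with hs | hs
  · have h1 := hb (-s⁻¹ • y) (-s⁻¹ * d) fun q hq => by
      have h2 : s⁻¹ * d ≤ s⁻¹ * (q.1 y + s * q.2) := by
        gcongr
        exact (hdv q hq).le
      rw [mul_add, inv_mul_cancel_left₀ hs.ne'] at h2
      rw [map_smul, smul_eq_mul]
      linarith
    have h3 := hcu γ ⟨min_le_right _ _, le_rfl⟩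
    have h4 : s⁻¹ * (u y + s * γ) < s⁻¹ * d := by
      gcongr
      linarith
    rw [mul_add, inv_mul_cancel_left₀ hs.ne'] at h4
    rw [map_smul, smul_eq_mul] at h1
    linarith
  · obtain ⟨z, a, hz⟩ := hne
    have h3 := hcu m' ⟨le_rfl, min_le_right _ _⟩
    obtain ⟨n, hn⟩ := exists_nat_gt ((a - (u z - γ)) / (d - c))
    rw [div_lt_iff₀ (by linarith)] at hn
    have h1 := hb (z - (n : ℝ) • y) (a - n * (u y + (d - c))) fun q hq => by
      have h4 := hdv q hq
      have h5 : m' ≤ q.2 := (min_le_left _ _).trans (hm q (subset_closure hq))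
      have h6 : u y + (d - c) ≤ q.1 y := by nlinarith
      have h7 : (n : ℝ) * (u y + (d - c)) ≤ n * q.1 y := by gcongr
      have h8 := hz q hq
      rw [map_sub, map_smul, smul_eq_mul]
      linarith
    rw [map_sub, map_smul, smul_eq_mul] at h1
    linarith

lemma mem_add_smul_closedBall {S : Set X} {x : X} {ρ : ℝ} (hρ : 0 ≤ ρ) :
    x ∈ S + ρ • Metric.closedBall (0 : X) 1 ↔ ∃ y ∈ Metric.closedBall x ρ, y ∈ S := by
  rw [smul_unitClosedBall_of_nonneg hρ, Set.mem_add]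
  constructor
  · rintro ⟨y, hy, z, hz, rfl⟩
    exact ⟨y, by simpa [dist_eq_norm] using hz, hy⟩
  · rintro ⟨y, hy, hyS⟩
    refine ⟨y, hyS, x - y, ?_, by abel⟩
    rwa [mem_closedBall_zero_iff, norm_sub_rev, ← mem_closedBall_iff_norm]

/-- Pairs `(u, ⟨u, x₀⟩)` in the closed characteristic set bound the Lipschitz moduli from below. -/
lemma one_le_mul_norm_of_lipschitzLikeWith (hf : ∀ t, IsProperLscConvex (f t)) {x₀ : X}
    (hx₀ : x₀ ∈ feasible f 0) {ℓ : ℝ≥0} (hℓ : LipschitzLikeWith (feasible f) 0 x₀ ℓ)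
    {u : WeakDual ℝ X} (hu : (u, u x₀) ∈ closure (charSet f)) :
    1 ≤ (ℓ : ℝ) * ‖WeakDual.toStrongDual u‖ := by
  obtain ⟨U, hU, V, hV, h⟩ := hℓ
  obtain ⟨δ, hδ, hδU⟩ := Metric.mem_nhds_iff.1 hU
  have hε : 0 < δ / 2 := half_pos hδ
  have hnorm : ‖constLp T (-(δ / 2))‖ ≤ δ / 2 :=
    (norm_constLp_le _).trans_eq (by rw [abs_neg, abs_of_pos hε])
  have hmem := h 0 (mem_of_mem_nhds hU) (constLp T (-(δ / 2)))
    (hδU (by rw [mem_ball_zero_iff]; linarith)) ⟨hx₀, mem_of_mem_nhds hV⟩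
  rw [mem_add_smul_closedBall (by positivity), zero_sub, norm_neg] at hmem
  obtain ⟨y, hy, hyf⟩ := hmem
  have h1 : u y - u x₀ ≤ -(δ / 2) := sub_le_of_mem_closure_charSet hf hyf hu
  have h2 : u (x₀ - y) ≤ ‖WeakDual.toStrongDual u‖ * ‖x₀ - y‖ :=
    (le_abs_self _).trans ((WeakDual.toStrongDual u).le_opNorm _)
  rw [mem_closedBall_iff_norm, norm_sub_rev] at hy
  have h3 : ‖WeakDual.toStrongDual u‖ * ‖x₀ - y‖ ≤
      ‖WeakDual.toStrongDual u‖ * (ℓ * (δ / 2)) := by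
    gcongr
    exact hy.trans (by gcongr)
  rw [map_sub] at h2
  refine le_of_mul_le_mul_right ?_ hε
  linarith

/-- By `lipschitz_bound` the Slater slack persists near `x₀`, so nearby points are feasible for all
small `q` and the modulus `0` works. -/
lemma lip_eq_zero_of_isStrongSlaterPoint (hf : ∀ t, IsProperLscConvex (f t)) {x₀ : X} {R : ℝ}
    (hR : ∀ t, ∀ u ∈ domConjugate (f t), ‖u‖ ≤ R) (h : IsStrongSlaterPoint f x₀) :
    lip (feasible f) 0 x₀ = 0 := by
  obtain ⟨δ, hδ, hx⟩ := exists_of_isStrongSlaterPoint h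
  have hR1 : 0 < |R| + 1 := by positivity
  have hw : LipschitzLikeWith (feasible f) 0 x₀ 0 := by
    refine ⟨Metric.ball 0 (δ / 2), Metric.ball_mem_nhds _ (by positivity),
      Metric.ball x₀ (δ / 2 / (|R| + 1)), Metric.ball_mem_nhds _ (by positivity), ?_⟩
    rintro p - q hq x ⟨-, hxV⟩
    rw [mem_ball_zero_iff] at hq
    rw [mem_ball_iff_norm, lt_div_iff₀ hR1] at hxV
    rw [NNReal.coe_zero, zero_mul, mem_add_smul_closedBall le_rfl]
    refine ⟨x, Metric.mem_closedBall_self le_rfl, fun t => ?_⟩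
    refine (lipschitz_bound hf hR hx x t).trans ?_
    rw [EReal.coe_le_coe_iff]
    have h1 := (abs_le.1 (abs_apply_le_norm q t)).1
    nlinarith [le_abs_self R, norm_nonneg (x - x₀)]
  exact le_antisymm (iInf₂_le 0 hw) zero_le

/-- If `ℓ⁻¹` is smaller than all norms `‖u‖` with `(u, ⟨u, x₀⟩)` in the closed characteristic set,
then `ℓ` is a Lipschitz modulus. -/
lemma lipschitzLikeWith_of_forall_lt (hf : ∀ t, IsProperLscConvex (f t))
    (hS : StrongSlaterCondition f) {x₀ : X} (hx₀ : x₀ ∈ feasible f 0) {R : ℝ}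
    (hR : ∀ t, ∀ u ∈ domConjugate (f t), ‖u‖ ≤ R) {ℓ : ℝ≥0} (hℓ0 : 0 < ℓ)
    (hℓ : ∀ u : WeakDual ℝ X, (u, u x₀) ∈ closure (charSet f) →
      1 < (ℓ : ℝ) * ‖WeakDual.toStrongDual u‖) :
    LipschitzLikeWith (feasible f) 0 x₀ ℓ := by
  have hℓ0' : (0 : ℝ) < ℓ := hℓ0
  have hfeas : ∀ q ∈ closure (charSet f), q.1 x₀ - q.2 ≤ 0 :=
    fun q hq => sub_le_of_mem_closure_charSet hf hx₀ hq
  -- No pair with norm at most `ℓ⁻¹` is active at `x₀`; compactness turns this into a uniform gap.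
  obtain ⟨η, hη, hη1, hgap⟩ : ∃ η > 0, η ≤ 1 ∧ ∀ q ∈ closure (charSet f),
      ‖WeakDual.toStrongDual q.1‖ ≤ (ℓ : ℝ)⁻¹ → q.1 x₀ - q.2 ≤ -η := by
    set K := {q ∈ closure (charSet f) | -1 ≤ q.1 x₀ - q.2} ∩
      (Prod.fst ⁻¹' (WeakDual.toStrongDual ⁻¹' Metric.closedBall (0 : StrongDual ℝ X) (ℓ : ℝ)⁻¹))
      with hK
    have hKc : IsCompact K := (isCompact_charSet_sublevel hR hfeas 1).inter_right
      ((WeakDual.isClosed_closedBall _ _).preimage continuous_fst)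
    rcases K.eq_empty_or_nonempty with hemp | hne
    · refine ⟨1, one_pos, le_rfl, fun q hq hn => ?_⟩
      by_contra! hlt
      exact (hemp ▸ (⟨⟨hq, hlt.le⟩, by simpa using hn⟩ : q ∈ K) : q ∈ (∅ : Set _))
    · obtain ⟨p, ⟨⟨hp, hp1⟩, hpn⟩, hmax⟩ :=
        hKc.exists_isMaxOn hne (continuous_weakDual_prod x₀).continuousOn
      have hlt : p.1 x₀ - p.2 < 0 := by
        refine lt_of_le_of_ne (hfeas p hp) fun h0 => ?_
        have hp2 : p.1 x₀ = p.2 := sub_eq_zero.1 h0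
        have h1 := hℓ p.1 (by rw [hp2]; exact hp)
        have h2 : ‖WeakDual.toStrongDual p.1‖ ≤ (ℓ : ℝ)⁻¹ := by simpa using hpn
        have h3 : (ℓ : ℝ) * ‖WeakDual.toStrongDual p.1‖ ≤ ℓ * (ℓ : ℝ)⁻¹ := by gcongr
        rw [mul_inv_cancel₀ hℓ0'.ne'] at h3
        linarith
      refine ⟨-(p.1 x₀ - p.2), by linarith, by linarith, fun q hq hn => ?_⟩
      rw [neg_neg]
      by_contra! hcon
      have : q.1 x₀ - q.2 ≤ p.1 x₀ - p.2 :=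
        hmax (⟨⟨hq, by linarith⟩, by simpa using hn⟩ : q ∈ K)
      linarith
  obtain ⟨xs, hxs⟩ := hS
  obtain ⟨δ, hδ, hxs⟩ := exists_of_isStrongSlaterPoint hxs
  have hm : ∀ q ∈ closure (charSet f), -(R * ‖xs‖) ≤ q.2 := fun q hq => by
    have h1 := sub_le_of_mem_closure_charSet hf hxs hq
    have h2 := (WeakDual.toStrongDual q.1).le_of_opNorm_le
      (norm_le_of_mem_closure_charSet hR hq) xs
    have h3 : -(R * ‖xs‖) ≤ q.1 xs := (abs_le.1 h2).1
    linarith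
  -- Passing from `q` to `0` and from `x` to `x₀` costs less than `η / 4` and at most `η / 4`, which
  -- together stay below the gap `η`.
  refine ⟨Metric.ball 0 (η / 4), Metric.ball_mem_nhds _ (by positivity),
    Metric.ball x₀ (ℓ * (η / 4)), Metric.ball_mem_nhds _ (by positivity), ?_⟩
  rintro p - q hq x ⟨hxp, hxV⟩
  rw [mem_add_smul_closedBall (by positivity)]
  rcases eq_or_ne p q with rfl | hpq
  · exact ⟨x, Metric.mem_closedBall_self (by positivity), hxp⟩
  by_contra! hdisj
  have hr : 0 < ‖p - q‖ := norm_sub_pos_iff.2 hpq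
  have hxq : ∀ t, f t x ≤ ((q t + ‖p - q‖ : ℝ) : EReal) := fun t => (hxp t).trans (by
    rw [EReal.coe_le_coe_iff]
    linarith [(abs_le.1 (abs_apply_sub_le p q t)).2])
  obtain ⟨u, γ, hu, hux⟩ := exists_affine_minorant_of_disjoint_closedBall hf
    (by positivity : 0 < (ℓ : ℝ) * ‖p - q‖) hxq hdisj
  have hun : ‖u‖ ≤ (ℓ : ℝ)⁻¹ := by
    have h1 := hux.trans (hu x _ hxq)
    rw [← one_div, le_div_iff₀ hℓ0']
    refine le_of_mul_le_mul_right ?_ hr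
    linarith
  obtain ⟨γ', hγ', hmem⟩ := exists_mem_closure_charSet_le hf hm
    ⟨x₀, 0, fun q hq => hfeas q (subset_closure hq)⟩ (u := u) (γ := γ + ‖q‖) fun z s hz => by
      have := hu z (s + ‖q‖) fun t => (hz t).trans (by
        rw [EReal.coe_le_coe_iff]
        linarith [(abs_le.1 (abs_apply_le_norm q t)).1])
      linarith
  have h1 : u x₀ - γ' ≤ -η := hgap _ hmem hun
  have h2 : 0 ≤ u x - γ := le_trans (by positivity) hux
  have h3 : u (x - x₀) ≤ η / 4 := by
    rw [mem_ball_iff_norm] at hxV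
    calc u (x - x₀) ≤ ‖u‖ * ‖x - x₀‖ := (le_abs_self _).trans (u.le_opNorm _)
      _ ≤ (ℓ : ℝ)⁻¹ * (ℓ * (η / 4)) := by gcongr
      _ = η / 4 := inv_mul_cancel_left₀ hℓ0'.ne' _
  rw [mem_ball_zero_iff] at hq
  rw [map_sub] at h3
  linarith

/-- At a feasible point which is not a strong Slater point, some `(u, ⟨u, x₀⟩)` lies in the closed
characteristic set. -/
lemma exists_active_charSet (hf : ∀ t, IsProperLscConvex (f t)) {x₀ : X}
    (hx₀ : x₀ ∈ feasible f 0) {R : ℝ} (hR : ∀ t, ∀ u ∈ domConjugate (f t), ‖u‖ ≤ R)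
    (h : ¬ IsStrongSlaterPoint f x₀) : ∃ q ∈ closure (charSet f), q.1 x₀ - q.2 = 0 := by
  have hfeas : ∀ q ∈ closure (charSet f), q.1 x₀ - q.2 ≤ 0 :=
    fun q hq => sub_le_of_mem_closure_charSet hf hx₀ hq
  have happrox : ∀ ε > 0, ∃ q ∈ charSet f, -ε < q.1 x₀ - q.2 := by
    intro ε hε
    by_contra! hcon
    exact h (isStrongSlaterPoint_of_forall_le hε (le_of_forall_charSet hf hcon))
  have hne : {q ∈ closure (charSet f) | -1 ≤ q.1 x₀ - q.2}.Nonempty := by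
    obtain ⟨q, hq, hq1⟩ := happrox 1 one_pos
    exact ⟨q, subset_closure hq, hq1.le⟩
  obtain ⟨p, ⟨hp, -⟩, hmax⟩ := (isCompact_charSet_sublevel hR hfeas 1).exists_isMaxOn hne
    (continuous_weakDual_prod x₀).continuousOn
  refine ⟨p, hp, le_antisymm (hfeas p hp) (le_of_forall_pos_le_add fun ε hε => ?_)⟩
  obtain ⟨q, hq, hqε⟩ := happrox (min ε 1) (lt_min hε one_pos)
  have h1 : q.1 x₀ - q.2 ≤ p.1 x₀ - p.2 :=
    isMaxOn_iff.1 hmax q ⟨subset_closure hq, by linarith [min_le_right ε 1]⟩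
  linarith [min_le_left ε 1]

/-- Among the pairs `(u, ⟨u, x₀⟩)` in the closed characteristic set, one has minimal norm. -/
lemma exists_min_norm (hf : ∀ t, IsProperLscConvex (f t)) {x₀ : X} (hx₀ : x₀ ∈ feasible f 0)
    {R : ℝ} (hR : ∀ t, ∀ u ∈ domConjugate (f t), ‖u‖ ≤ R) (h : ¬ IsStrongSlaterPoint f x₀) :
    ∃ u : WeakDual ℝ X, (u, u x₀) ∈ closure (charSet f) ∧
      ∀ v : WeakDual ℝ X, (v, v x₀) ∈ closure (charSet f) →
        ‖WeakDual.toStrongDual u‖ ≤ ‖WeakDual.toStrongDual v‖ := by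
  have hfeas : ∀ q ∈ closure (charSet f), q.1 x₀ - q.2 ≤ 0 :=
    fun q hq => sub_le_of_mem_closure_charSet hf hx₀ hq
  obtain ⟨p, hp, hp0⟩ := exists_active_charSet hf hx₀ hR h
  have hne : {q ∈ closure (charSet f) | -0 ≤ q.1 x₀ - q.2}.Nonempty :=
    ⟨p, hp, by rw [hp0, neg_zero]⟩
  obtain ⟨q, hq, hmin⟩ :=
    (lowerSemicontinuous_weakDual_norm_fst.lowerSemicontinuousOn _).exists_isMinOn hne
      (isCompact_charSet_sublevel hR hfeas 0)
  have hq2 : q.1 x₀ = q.2 := by linarith [hfeas q hq.1, hq.2]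
  refine ⟨q.1, hq2 ▸ hq.1, fun v hv => ?_⟩
  exact isMinOn_iff.1 hmin (v, v x₀) ⟨hv, by simp only [neg_zero, sub_self, le_refl]⟩

/-- With `u = 0` the pair would be `(0, 0)`, contradicting the strictly negative bound at a Slater
point. -/
lemma ne_zero_of_mem_closure_charSet (hf : ∀ t, IsProperLscConvex (f t))
    (hS : StrongSlaterCondition f) {x₀ : X} {u : WeakDual ℝ X}
    (hu : (u, u x₀) ∈ closure (charSet f)) : 0 < ‖WeakDual.toStrongDual u‖ := by
  obtain ⟨y, hy⟩ := hS
  obtain ⟨δ, hδ, hy⟩ := exists_of_isStrongSlaterPoint hy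
  rw [norm_pos_iff]
  intro h0
  have h1 : u y - u x₀ ≤ -δ := sub_le_of_mem_closure_charSet hf hy hu
  have h2 : ∀ z, u z = 0 := fun z => by
    rw [← WeakDual.toStrongDual_apply, h0, zero_apply]
  rw [h2, h2] at h1
  linarith

lemma lip_eq_of_min_norm (hf : ∀ t, IsProperLscConvex (f t)) (hS : StrongSlaterCondition f)
    {x₀ : X} (hx₀ : x₀ ∈ feasible f 0) {R : ℝ}
    (hR : ∀ t, ∀ u ∈ domConjugate (f t), ‖u‖ ≤ R) {u : WeakDual ℝ X}
    (hu : (u, u x₀) ∈ closure (charSet f))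
    (hmin : ∀ v : WeakDual ℝ X, (v, v x₀) ∈ closure (charSet f) →
      ‖WeakDual.toStrongDual u‖ ≤ ‖WeakDual.toStrongDual v‖) :
    lip (feasible f) 0 x₀ = ‖WeakDual.toStrongDual u‖ₑ⁻¹ := by
  have hpos := ne_zero_of_mem_closure_charSet hf hS hu
  have hpos' : ‖WeakDual.toStrongDual u‖₊ ≠ 0 := ne_of_gt (by exact_mod_cast hpos)
  rw [enorm_eq_nnnorm, ← ENNReal.coe_inv hpos']
  refine le_antisymm (le_of_forall_gt fun r hr => ?_) (le_iInf₂ fun ℓ hℓ => ?_)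
  -- The sufficient condition for a modulus is strict, so the infimum is approached from above.
  · obtain ⟨ℓ, hℓ, hℓr⟩ := ENNReal.lt_iff_exists_nnreal_btwn.1 hr
    rw [ENNReal.coe_lt_coe] at hℓ
    refine (iInf₂_le ℓ (lipschitzLikeWith_of_forall_lt hf hS hx₀ hR
      (zero_le.trans_lt hℓ) fun v hv => ?_)).trans_lt hℓr
    rw [← NNReal.coe_lt_coe, NNReal.coe_inv, coe_nnnorm, ← one_div, div_lt_iff₀ hpos] at hℓ
    exact hℓ.trans_le (by gcongr; exact hmin v hv)
  · rw [ENNReal.coe_le_coe, ← NNReal.coe_le_coe, NNReal.coe_inv, coe_nnnorm, ← one_div,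
      div_le_iff₀ hpos]
    exact one_le_mul_norm_of_lipschitzLikeWith hf hx₀ hℓ hu

end LipschitzBound

end ConvexSystem

theorem mainTheorem1 {X T : Type*} [NormedAddCommGroup X] [NormedSpace ℝ X] [CompleteSpace X]
    (f : T → X → EReal) (hf : ∀ t, ConvexSystem.IsProperLscConvex (f t))
    (x₀ : X) (hx₀ : x₀ ∈ ConvexSystem.feasible f 0) :
    (ConvexSystem.LipschitzLike (ConvexSystem.feasible f) 0 x₀ ↔
      ConvexSystem.coderivative (ConvexSystem.feasible f) 0 x₀ 0 = {0}) ∧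
    (ConvexSystem.StrongSlaterCondition f →
      Bornology.IsBounded (⋃ t, ConvexSystem.domConjugate (f t)) →
      (ConvexSystem.IsStrongSlaterPoint f x₀ →
        ConvexSystem.lip (ConvexSystem.feasible f) 0 x₀ = 0) ∧
      (¬ ConvexSystem.IsStrongSlaterPoint f x₀ →
        IsGreatest
          {r : ℝ≥0∞ | ∃ u : WeakDual ℝ X, (u, u x₀) ∈ closure (ConvexSystem.charSet f) ∧
            r = ‖WeakDual.toStrongDual u‖ₑ⁻¹}
          (ConvexSystem.lip (ConvexSystem.feasible f) 0 x₀) ∧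
        0 < ConvexSystem.lip (ConvexSystem.feasible f) 0 x₀ ∧
        ConvexSystem.lip (ConvexSystem.feasible f) 0 x₀ < ⊤)) := by
  refine ⟨ConvexSystem.lipschitzLike_iff_coderivative_eq hf hx₀, fun hS hbd => ?_⟩
  obtain ⟨R, hR⟩ := hbd.exists_norm_le
  have hR : ∀ t, ∀ u ∈ ConvexSystem.domConjugate (f t), ‖u‖ ≤ R :=
    fun t u hu => hR u (Set.mem_iUnion.2 ⟨t, hu⟩)
  refine ⟨ConvexSystem.lip_eq_zero_of_isStrongSlaterPoint hf hR, fun hns => ?_⟩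
  obtain ⟨u, hu, hmin⟩ := ConvexSystem.exists_min_norm hf hx₀ hR hns
  have hpos := ConvexSystem.ne_zero_of_mem_closure_charSet hf hS hu
  rw [ConvexSystem.lip_eq_of_min_norm hf hS hx₀ hR hu hmin]
  refine ⟨⟨⟨u, hu, rfl⟩, ?_⟩, ENNReal.inv_pos.2 enorm_ne_top, ENNReal.inv_lt_top.2 ?_⟩
  · rintro _ ⟨v, hv, rfl⟩
    rw [ENNReal.inv_le_inv, enorm_le_iff_norm_le]
    exact hmin v hv
  · rw [enorm_eq_nnnorm, ENNReal.coe_pos]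
    exact_mod_cast hpos
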